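/- For integers $k\ge 1$ and $r\ge 1$ let $$H_k^{(r)}=\sum_{j=1}^{k}\frac{1}{j^r},\qquad O_k^{(r)}=\sum_{j=1}^{k}\frac{1}{(2j-1)^r},\qquad H_k=H_k^{(1)},\quad O_k=O_k^{(1)},$$ and let $G=\sum_{k=0}^{\infty}\frac{(-1)^k}{(2k+1)^2}$ be Catalan's constant. Then the following four series converge, with the sums $$\sum_{k=1}^{\infty}\binom{2k}{k}^3\frac{H_k}{64^k}=\frac{2\pi(\pi-3\ln 2)}{3\,\Gamma(\frac34)^4},\qquad \sum_{k=1}^{\infty}\binom{2k}{k}^3\frac{O_k}{64^k}=\frac{\pi^2}{6\,\Gamma(\frac34)^4},$$ $$\sum_{k=1}^{\infty}\binom{2k}{k}^3\frac{H_k^{(2)}}{64^k}=\frac{\pi(12G-\pi^2)}{3\,\Gamma(\frac34)^4},\qquad \sum_{k=1}^{\infty}\binom{2k}{k}^3\frac{O_k^{(2)}}{64^k}=\frac{\pi(\pi^2-8G)}{8\,\Gamma(\frac34)^4}.$$ -/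

import Mathlib

noncomputable section

/-- The generalized harmonic number `H_k^{(r)} = ∑_{j=1}^k 1/j^r`. -/
def genHarmonic (r k : ℕ) : ℝ :=
  ∑ j ∈ Finset.Icc 1 k, 1 / (j : ℝ) ^ r

/-- The odd harmonic number `O_k^{(r)} = ∑_{j=1}^k 1/(2j-1)^r`. -/
def oddHarmonic (r k : ℕ) : ℝ :=
  ∑ j ∈ Finset.Icc 1 k, 1 / (2 * (j : ℝ) - 1) ^ r

/-- Catalan's constant `G = ∑_{k≥0} (-1)^k/(2k+1)^2` (an absolutely convergent series). -/
def catalanConst : ℝ :=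
  ∑' k : ℕ, (-1 : ℝ) ^ k / (2 * (k : ℝ) + 1) ^ 2

/-- The `k`-th term `C(2k,k)^3 X_k / 64^k` of the series attached to a sequence `X`. -/
def cubeTerm (X : ℕ → ℝ) (k : ℕ) : ℝ :=
  (Nat.choose (2 * k) k : ℝ) ^ 3 * (X k / 64 ^ k)

end

/-!
Let `S m` be the sum of the well-poised series `₃F₂(m - 1/2, 1/2, 1/2; m, m; 1)`, whose `k`-th term
at `m = 1` is `C(2k,k)^3 / 64^k`. Zeilberger's algorithm gives `S m = R m * S (m + 2)` with `R`
rational, and `S m → 1` as `m → ∞`, so `S m` is an infinite product of values of `R`, which is a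
quotient of Gamma functions.

Moving the parameters of the series to first order multiplies the `k`-th term by a sum of `k`
logarithmic derivatives, which for suitable directions is a combination of the harmonic numbers of
index `k` when `m = 1`. Along four such directions the telescoping identity can be differentiated
within rational functions. The weighted sum `T m` then satisfies
`T m / S m = ρ m + T (m + 2) / S (m + 2)`, where `ρ` is the logarithmic derivative of `R`, and
`T m → 0`, so that `T 1 / S 1 = ρ 1 + ρ 3 + ρ 5 + ⋯`. Each of these four sums is a
combination of the series for `π / 4`, `log 2`, `ζ(2)` and Catalan's constant.
-/

open Filter Topology Finset Asymptotics

section Sequences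

theorem tsum_eq_of_telescope {M : Type*} [AddCommGroup M] [TopologicalSpace M]
    [ContinuousSub M] [T2Space M] {f G : ℕ → M} {L : M} (hf : Summable f)
    (h : ∀ k, f k = G (k + 1) - G k) (hG : Tendsto G atTop (𝓝 L)) : ∑' k, f k = L - G 0 := by
  refine tendsto_nhds_unique hf.hasSum.tendsto_sum_nat ?_
  simp_rw [h, sum_range_sub]
  exact hG.sub_const _

theorem tendsto_sum_range_pairs {M : Type*} [AddCommMonoid M] [TopologicalSpace M] {f : ℕ → M}
    {s : M} (hf : Tendsto (fun n => ∑ i ∈ range n, f i) atTop (𝓝 s)) :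
    Tendsto (fun n => ∑ i ∈ range n, (f (2 * i) + f (2 * i + 1))) atTop (𝓝 s) := by
  refine (hf.comp (tendsto_id.const_mul_atTop' two_pos)).congr fun n => ?_
  simp only [Function.comp, id]
  induction n with
  | zero => simp
  | succ n ih =>
    change ∑ i ∈ range (2 * n + 1 + 1), f i = _
    rw [sum_range_succ _ n, ← ih, ← add_assoc, sum_range_succ, sum_range_succ]

theorem tendsto_sum_range_alternating_harmonic :
    Tendsto (fun n => ∑ i ∈ range n, (1 / (2 * (i : ℝ) + 1) - 1 / (2 * (i : ℝ) + 2))) atTop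
      (𝓝 (Real.log 2)) := by
  have hsum (n : ℕ) : ∑ i ∈ range n, (1 / (2 * (i : ℝ) + 1) - 1 / (2 * (i : ℝ) + 2)) =
      (harmonic (2 * n) : ℝ) - (harmonic n : ℝ) := by
    induction n with
    | zero => simp
    | succ n ih =>
      rw [sum_range_succ, ih, mul_add_one, harmonic_succ, harmonic_succ, harmonic_succ]
      push_cast
      field_simp
      ring
  have hlim := ((Real.tendsto_harmonic_sub_log.comp (tendsto_id.const_mul_atTop' two_pos)).sub
    Real.tendsto_harmonic_sub_log).add_const (Real.log 2)
  rw [sub_self, zero_add] at hlim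
  refine hlim.congr' ?_
  filter_upwards [eventually_ne_atTop 0] with n hn
  have hlog : Real.log ((2 * n : ℕ) : ℝ) = Real.log 2 + Real.log n := by
    rw [Nat.cast_mul, Nat.cast_ofNat, Real.log_mul two_ne_zero (Nat.cast_ne_zero.2 hn)]
  simp only [Function.comp, id, hsum, hlog]
  ring

theorem tendsto_sum_range_log_two_four_terms :
    Tendsto (fun n => ∑ i ∈ range n, (1 / (4 * (i : ℝ) + 1) - 1 / (4 * (i : ℝ) + 2) +
      1 / (4 * (i : ℝ) + 3) - 1 / (4 * (i : ℝ) + 4))) atTop (𝓝 (Real.log 2)) := by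
  refine (tendsto_sum_range_pairs tendsto_sum_range_alternating_harmonic).congr fun n =>
    sum_congr rfl fun i _ => ?_
  push_cast
  ring_nf

theorem tendsto_sum_range_leibniz_pairs :
    Tendsto (fun n => ∑ i ∈ range n, (1 / (4 * (i : ℝ) + 1) - 1 / (4 * (i : ℝ) + 3))) atTop
      (𝓝 (Real.pi / 4)) := by
  refine (tendsto_sum_range_pairs Real.tendsto_sum_pi_div_four).congr fun n =>
    sum_congr rfl fun i _ => ?_
  rw [(even_two_mul i).neg_one_pow, (odd_two_mul_add_one i).neg_one_pow]
  push_cast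
  ring_nf

theorem tendsto_sum_range_zeta_two_pairs :
    Tendsto (fun n => ∑ i ∈ range n, (1 / (2 * (i : ℝ) + 1) ^ 2 + 1 / (2 * (i : ℝ) + 2) ^ 2)) atTop
      (𝓝 (Real.pi ^ 2 / 6)) := by
  have hzeta := (hasSum_nat_add_iff' 1).2 hasSum_zeta_two
  simp only [range_one, sum_singleton, Nat.cast_zero, zero_pow two_ne_zero, div_zero,
    sub_zero] at hzeta
  refine (tendsto_sum_range_pairs hzeta.tendsto_sum_nat).congr fun n => sum_congr rfl fun i _ => ?_
  push_cast
  ring_nf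

theorem hasSum_one_div_odd_sq :
    HasSum (fun n : ℕ => 1 / (2 * (n : ℝ) + 1) ^ 2) (Real.pi ^ 2 / 8) := by
  have heven : HasSum (fun n : ℕ => 1 / ((2 * n : ℕ) : ℝ) ^ 2) (1 / 4 * (Real.pi ^ 2 / 6)) := by
    refine (hasSum_zeta_two.mul_left (1 / 4)).congr_fun fun n => ?_
    push_cast
    ring
  have hodd : Summable fun n : ℕ => 1 / ((2 * n + 1 : ℕ) : ℝ) ^ 2 :=
    hasSum_zeta_two.summable.comp_injective (i := fun n : ℕ => 2 * n + 1) fun a b h => by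
      simpa using h
  have htsum := (heven.even_add_odd (f := fun n : ℕ => 1 / (n : ℝ) ^ 2) hodd.hasSum).unique
    hasSum_zeta_two
  convert hodd.hasSum using 1
  · push_cast
    rfl
  · linarith

theorem hasSum_catalanConst :
    HasSum (fun k : ℕ => (-1 : ℝ) ^ k / (2 * (k : ℝ) + 1) ^ 2) catalanConst :=
  (hasSum_one_div_odd_sq.summable.of_norm_bounded fun k => by simp).hasSum

theorem hasSum_one_div_three_mod_four_sq :
    HasSum (fun n : ℕ => 1 / (4 * (n : ℝ) + 3) ^ 2) ((Real.pi ^ 2 / 8 - catalanConst) / 2) := by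
  have hdiff := (hasSum_one_div_odd_sq.sub hasSum_catalanConst).div_const 2
  have hinj : Function.Injective fun n : ℕ => 2 * n + 1 := fun a b h => by simpa using h
  rw [← hinj.hasSum_iff] at hdiff
  · refine hdiff.congr_fun fun n => ?_
    simp only [Function.comp_apply, (odd_two_mul_add_one n).neg_one_pow]
    push_cast
    ring
  · intro k hk
    have heven : Even k := Nat.not_odd_iff_even.1 fun ⟨j, hj⟩ => hk ⟨j, hj.symm⟩
    simp [heven.neg_one_pow]

theorem tendsto_prod_range_Gamma {a b c d : ℝ} (ha : 0 < a) (hb : 0 < b) (hc : 0 < c) (hd : 0 < d)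
    (h : a + b = c + d) :
    Tendsto (fun n => ∏ i ∈ range n, (c + i) * (d + i) / ((a + i) * (b + i))) atTop
      (𝓝 (Real.Gamma a * Real.Gamma b / (Real.Gamma c * Real.Gamma d))) := by
  have hlim := ((Real.GammaSeq_tendsto_Gamma a).mul (Real.GammaSeq_tendsto_Gamma b)).div
    ((Real.GammaSeq_tendsto_Gamma c).mul (Real.GammaSeq_tendsto_Gamma d))
    (mul_pos (Real.Gamma_pos_of_pos hc) (Real.Gamma_pos_of_pos hd)).ne'
  rw [← tendsto_add_atTop_iff_nat 1]
  refine hlim.congr' ?_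
  filter_upwards [eventually_gt_atTop 0] with n hn
  have hn' : (0 : ℝ) < n := Nat.cast_pos.2 hn
  have hpow : (n : ℝ) ^ a * (n : ℝ) ^ b = (n : ℝ) ^ c * (n : ℝ) ^ d := by
    rw [← Real.rpow_add hn', ← Real.rpow_add hn', h]
  have hprod {x : ℝ} (hx : 0 < x) : ∏ i ∈ range (n + 1), (x + i) ≠ 0 :=
    (prod_pos fun i _ => by positivity).ne'
  have hfact : (n.factorial : ℝ) ≠ 0 := Nat.cast_ne_zero.2 n.factorial_ne_zero
  have := hprod ha
  have := hprod hb
  have := hprod hc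
  have := hprod hd
  simp only [Pi.div_apply, Real.GammaSeq, prod_div_distrib, prod_mul_distrib]
  field_simp
  linear_combination hpow

theorem one_div_add_le {a k : ℝ} (ha : 1 / 2 ≤ a) (hk : 0 ≤ k) : 1 / (a + k) ≤ 2 / (k + 1) := by
  rw [div_le_div_iff₀ (by positivity) (by positivity)]
  linarith

theorem one_div_add_sq_le {a k : ℝ} (ha : 1 / 2 ≤ a) (hk : 0 ≤ k) :
    1 / (a + k) ^ 2 ≤ 4 / (k + 1) := by
  calc 1 / (a + k) ^ 2 = (1 / (a + k)) ^ 2 := by rw [one_div_pow]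
    _ ≤ (2 / (k + 1)) ^ 2 := pow_le_pow_left₀ (by positivity) (one_div_add_le ha hk) 2
    _ = 4 / (k + 1) * (1 / (k + 1)) := by ring
    _ ≤ 4 / (k + 1) := mul_le_of_le_one_right (by positivity) <|
        div_le_one_of_le₀ (by linarith) (by positivity)

theorem sum_range_one_div_succ_le {ε : ℝ} (hε : 0 < ε) (k : ℕ) :
    ∑ j ∈ range k, 1 / ((j : ℝ) + 1) ≤ (1 + 1 / ε) * ((k : ℝ) + 1) ^ ε := by
  have hharmonic : ∑ j ∈ range k, 1 / ((j : ℝ) + 1) ≤ 1 + Real.log (k + 1) := by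
    calc ∑ j ∈ range k, 1 / ((j : ℝ) + 1) ≤ ∑ j ∈ range (k + 1), 1 / ((j : ℝ) + 1) :=
          sum_le_sum_of_subset_of_nonneg (range_mono k.le_succ) fun j _ _ => by positivity
      _ ≤ 1 + Real.log (k + 1) := by
          simpa [harmonic, one_div] using harmonic_le_one_add_log (k + 1)
  have hlog : Real.log ((k : ℝ) + 1) ≤ ((k : ℝ) + 1) ^ ε / ε :=
    Real.log_le_rpow_div (by positivity) hε
  have hone : 1 ≤ ((k : ℝ) + 1) ^ ε :=
    Real.one_le_rpow (le_add_of_nonneg_left k.cast_nonneg) hε.le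
  linear_combination hharmonic + hlog + hone

theorem abs_sum_range_le {d : ℕ → ℝ} {C ε : ℝ} (hε : 0 < ε)
    (hd : ∀ j : ℕ, |d j| ≤ C / ((j : ℝ) + 1)) (k : ℕ) :
    |∑ j ∈ range k, d j| ≤ (1 + 1 / ε) * C * ((k : ℝ) + 1) ^ ε := by
  have hC : 0 ≤ C := by simpa using (abs_nonneg _).trans (hd 0)
  calc |∑ j ∈ range k, d j| ≤ ∑ j ∈ range k, |d j| := abs_sum_le_sum_abs _ _
    _ ≤ ∑ j ∈ range k, C * (1 / ((j : ℝ) + 1)) :=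
        sum_le_sum fun j _ => (hd j).trans_eq (by ring)
    _ = C * ∑ j ∈ range k, 1 / ((j : ℝ) + 1) := (mul_sum _ _ _).symm
    _ ≤ C * ((1 + 1 / ε) * ((k : ℝ) + 1) ^ ε) := by
        gcongr
        exact sum_range_one_div_succ_le hε k
    _ = (1 + 1 / ε) * C * ((k : ℝ) + 1) ^ ε := by ring

theorem isBigO_mul_quadratic_div_sq (m A B C : ℝ) :
    (fun k : ℝ => k * (A * k ^ 2 + B * k + C) / (m + k) ^ 2) =O[atTop] fun k => k := by
  have hquad : (fun k : ℝ => A * k ^ 2 + B * k + C) =O[atTop] fun k => (m + k) ^ 2 := by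
    have h := Polynomial.isBigO_atTop_of_degree_le
      (.C A * .X ^ 2 + .C B * .X + .C C : Polynomial ℝ) ((.C m + .X) ^ 2) <| by
        rw [Polynomial.degree_pow, add_comm (Polynomial.C m), Polynomial.degree_X_add_C]
        exact Polynomial.degree_quadratic_le
    simpa using h
  have hbdd : (fun k : ℝ => (m + k) ^ 2 * ((m + k) ^ 2)⁻¹) =O[atTop] fun _ => (1 : ℝ) :=
    .of_bound 1 <| .of_forall fun k => by
      rw [Real.norm_of_nonneg (by positivity), norm_one, one_mul]
      exact mul_inv_le_one
  have := (isBigO_refl (fun k : ℝ => k) atTop).mul ((hquad.mul (isBigO_refl _ _)).trans hbdd)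
  simpa only [mul_one, ← div_eq_mul_inv, mul_div_assoc] using this

theorem isBigO_one_div_add (m : ℝ) :
    (fun k : ℝ => 1 / (m + k)) =O[atTop] fun _ => (1 : ℝ) :=
  (tendsto_const_nhds.div_atTop (tendsto_atTop_add_const_left _ m tendsto_id)).isBigO_one ℝ

end Sequences

noncomputable section

/-- The quotient `dixonTerm m (k + 1) / dixonTerm m k`, as a rational function of `m` and `k`. -/
def stepRatio (m k : ℝ) : ℝ := (k + 1 / 2) ^ 2 * (m - 1 / 2 + k) / ((k + 1) * (m + k) ^ 2)

/-- The quotient `dixonSum m / dixonSum (m + 2) * dixonTerm (m + 2) k / dixonTerm m k`, as a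
rational function of `m` and `k`; its value at `k = 0` is `dixonSum m / dixonSum (m + 2)`. -/
def shiftRatio (m k : ℝ) : ℝ :=
  (m + 1 / 2) ^ 3 * (m - 1 / 2 + k) * (m + 1 / 2 + k) /
    ((m - 1 / 2) * ((m + k) * (m + k + 1)) ^ 2)

/-- The rational certificate, found by Zeilberger's algorithm, which makes
`dixonTerm m k - shiftRatio m 0 * dixonTerm (m + 2) k` telescope in `k`. -/
def cert (m k : ℝ) : ℝ :=
  k * (1 / 4 - (k + m - 1 / 2) * (k + 2 * m)) / ((m - 1 / 2) * (m + k) ^ 2)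

/-- The summand of the well-poised hypergeometric series `₃F₂(m - 1/2, 1/2, 1/2; m, m; 1)`, whose
sum is given by Dixon's theorem. At `m = 1` it is `(C(2k,k) / 4^k)^3`. -/
def dixonTerm (m : ℝ) (k : ℕ) : ℝ := ∏ j ∈ range k, stepRatio m j

/-- The sum of the series `₃F₂(m - 1/2, 1/2, 1/2; m, m; 1)`. -/
def dixonSum (m : ℝ) : ℝ := ∑' k, dixonTerm m k

end

section DixonTerm

theorem centralBinom_div_four_pow_succ (k : ℕ) :
    ((k + 1).centralBinom : ℝ) / 4 ^ (k + 1) =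
      (k.centralBinom : ℝ) / 4 ^ k * (((k : ℝ) + 1 / 2) / (k + 1)) := by
  have hrec : ((k : ℝ) + 1) * (k + 1).centralBinom = 2 * (2 * k + 1) * k.centralBinom := by
    exact_mod_cast Nat.succ_mul_centralBinom_succ k
  field_simp
  linear_combination 2 * 4 ^ k * hrec

theorem centralBinom_div_four_pow_sq_le (k : ℕ) :
    ((k.centralBinom : ℝ) / 4 ^ k) ^ 2 ≤ 1 / ((k : ℝ) + 1) := by
  induction k with
  | zero => simp
  | succ k ih =>
    calc (((k + 1).centralBinom : ℝ) / 4 ^ (k + 1)) ^ 2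
        = ((k.centralBinom : ℝ) / 4 ^ k) ^ 2 * (((k : ℝ) + 1 / 2) / (k + 1)) ^ 2 := by
          rw [centralBinom_div_four_pow_succ, mul_pow]
      _ ≤ 1 / ((k : ℝ) + 1) * (((k : ℝ) + 1 / 2) / (k + 1)) ^ 2 := by gcongr
      _ ≤ 1 / (((k + 1 : ℕ) : ℝ) + 1) := by
          push_cast
          rw [div_pow, div_mul_div_comm, div_le_div_iff₀ (by positivity) (by positivity)]
          nlinarith [k.cast_nonneg (α := ℝ)]

theorem centralBinom_div_four_pow_le (k : ℕ) :
    (k.centralBinom : ℝ) / 4 ^ k ≤ ((k : ℝ) + 1) ^ (-(1 / 2) : ℝ) := by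
  refine le_of_sq_le_sq ((centralBinom_div_four_pow_sq_le k).trans_eq ?_) (by positivity)
  rw [← Real.rpow_mul_natCast (by positivity), one_div, ← Real.rpow_neg_one]
  norm_num

@[simp]
theorem dixonTerm_zero (m : ℝ) : dixonTerm m 0 = 1 := prod_range_zero _

theorem dixonTerm_succ (m : ℝ) (k : ℕ) :
    dixonTerm m (k + 1) = dixonTerm m k * stepRatio m k :=
  prod_range_succ _ _

theorem dixonTerm_one (k : ℕ) : dixonTerm 1 k = ((k.centralBinom : ℝ) / 4 ^ k) ^ 3 := by
  induction k with
  | zero => simp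
  | succ k ih =>
    rw [dixonTerm_succ, ih, centralBinom_div_four_pow_succ, mul_pow, stepRatio]
    field_simp
    ring

variable {m : ℝ}

theorem stepRatio_nonneg {k : ℝ} (hm : 1 ≤ m) (hk : 0 ≤ k) : 0 ≤ stepRatio m k := by
  have : 0 ≤ m - 1 / 2 := by linarith
  unfold stepRatio
  positivity

theorem stepRatio_antitoneOn {k : ℝ} (hk : 0 ≤ k) :
    AntitoneOn (fun m => stepRatio m k) (Set.Ici 1) := by
  intro a (ha : 1 ≤ a) b (hb : 1 ≤ b) hab
  have hfactor (m : ℝ) : stepRatio m k =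
      (k + 1 / 2) ^ 2 / (k + 1) * ((m + k - 1 / 2) / (m + k) ^ 2) := by
    rw [stepRatio, div_mul_div_comm, sub_add_eq_add_sub]
  have hquot : (b + k - 1 / 2) / (b + k) ^ 2 ≤ (a + k - 1 / 2) / (a + k) ^ 2 := by
    rw [div_le_div_iff₀ (by positivity) (by positivity)]
    have hx : 0 ≤ (a + k) * (b + k - 1) := mul_nonneg (by positivity) (by linarith)
    have hy : 0 ≤ (b + k) * (a + k - 1) := mul_nonneg (by positivity) (by linarith)
    linear_combination (b - a) / 2 * hx + (b - a) / 2 * hy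
  simp only [hfactor]
  gcongr

theorem dixonTerm_nonneg (hm : 1 ≤ m) (k : ℕ) : 0 ≤ dixonTerm m k :=
  prod_nonneg fun j _ => stepRatio_nonneg hm j.cast_nonneg

theorem dixonTerm_antitoneOn (k : ℕ) : AntitoneOn (fun m => dixonTerm m k) (Set.Ici 1) :=
  fun _ ha _ hb hab => prod_le_prod (fun j _ => stepRatio_nonneg hb j.cast_nonneg)
    fun j _ => stepRatio_antitoneOn j.cast_nonneg ha hb hab

theorem dixonTerm_le (hm : 1 ≤ m) (k : ℕ) : dixonTerm m k ≤ ((k : ℝ) + 1) ^ (-(3 / 2) : ℝ) := by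
  calc dixonTerm m k ≤ dixonTerm 1 k := dixonTerm_antitoneOn k Set.self_mem_Ici hm hm
    _ = ((k.centralBinom : ℝ) / 4 ^ k) ^ 3 := dixonTerm_one k
    _ ≤ (((k : ℝ) + 1) ^ (-(1 / 2) : ℝ)) ^ 3 := by
        gcongr
        exact centralBinom_div_four_pow_le k
    _ = ((k : ℝ) + 1) ^ (-(3 / 2) : ℝ) := by
        rw [← Real.rpow_mul_natCast (by positivity)]
        norm_num

theorem dixonTerm_succ_le_div (hm : 1 ≤ m) (k : ℕ) : dixonTerm m (k + 1) ≤ (k + 1) / m := by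
  have hm' : 0 ≤ m - 1 / 2 := by linarith
  have hterm : dixonTerm m k ≤ 1 := (dixonTerm_le hm k).trans
    (Real.rpow_le_one_of_one_le_of_nonpos (le_add_of_nonneg_left k.cast_nonneg) (by norm_num))
  have hstep : stepRatio m k ≤ (k + 1) / m := by
    rw [stepRatio, div_le_div_iff₀ (by positivity) (by positivity)]
    calc ((k : ℝ) + 1 / 2) ^ 2 * (m - 1 / 2 + k) * m
        ≤ ((k : ℝ) + 1) ^ 2 * (m + k) * (m + k) := by gcongr <;> linarith [k.cast_nonneg (α := ℝ)]
      _ = ((k : ℝ) + 1) * ((k + 1) * (m + k) ^ 2) := by ring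
  rw [dixonTerm_succ, ← one_mul (((k : ℝ) + 1) / m)]
  exact mul_le_mul hterm hstep (stepRatio_nonneg hm k.cast_nonneg) zero_le_one

theorem tendsto_dixonTerm {k : ℕ} (hk : k ≠ 0) : Tendsto (fun m => dixonTerm m k) atTop (𝓝 0) := by
  obtain ⟨k, rfl⟩ := Nat.exists_eq_succ_of_ne_zero hk
  refine squeeze_zero' ?_ ?_ (tendsto_const_nhds.div_atTop tendsto_id : Tendsto
    (fun m : ℝ => ((k : ℝ) + 1) / m) atTop (𝓝 0))
  · filter_upwards [eventually_ge_atTop 1] with m hm using dixonTerm_nonneg hm _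
  · filter_upwards [eventually_ge_atTop 1] with m hm using dixonTerm_succ_le_div hm k

theorem shiftRatio_mul_dixonTerm (hm : 1 ≤ m) (k : ℕ) :
    shiftRatio m 0 * dixonTerm (m + 2) k = shiftRatio m k * dixonTerm m k := by
  induction k with
  | zero => simp
  | succ k ih =>
    have hstep : shiftRatio m k * stepRatio (m + 2) k =
        shiftRatio m (k + 1) * stepRatio m k := by
      have h₁ : m + 2 + (k : ℝ) = m + (k + 1) + 1 := by ring
      have h₂ : m + (k : ℝ) + 1 = m + (k + 1) := by ring
      have h₃ : m + 2 - 1 / 2 + (k : ℝ) = m + 1 / 2 + (k + 1) := by ring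
      have h₄ : m + 1 / 2 + (k : ℝ) = m - 1 / 2 + (k + 1) := by ring
      rw [shiftRatio, shiftRatio, stepRatio, stepRatio, h₁, h₂, h₃, h₄]
      field_simp
    rw [dixonTerm_succ, dixonTerm_succ, ← mul_assoc, ih, Nat.cast_succ]
    linear_combination dixonTerm m k * hstep

theorem one_sub_shiftRatio {k : ℝ} (hm : 1 ≤ m) (hk : 0 ≤ k) :
    1 - shiftRatio m k = cert m (k + 1) * stepRatio m k - cert m k := by
  have hm₀ : m * 2 - 1 ≠ 0 := by linarith
  unfold shiftRatio cert stepRatio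
  rw [← add_assoc m k 1]
  field_simp
  ring

theorem cert_zero (m : ℝ) : cert m 0 = 0 := by
  simp [cert]

theorem isBigO_cert (m : ℝ) : cert m =O[atTop] fun k => k := by
  refine (isBigO_mul_quadratic_div_sq m (-1 / (m - 1 / 2)) (-(3 * m - 1 / 2) / (m - 1 / 2))
    ((1 / 4 - (m - 1 / 2) * (2 * m)) / (m - 1 / 2))).congr_left fun k => ?_
  rw [cert, ← div_div]
  ring

theorem isBigO_mul_quadratic_div_sq_add_cert_mul (m A B C : ℝ) {w : ℝ → ℝ}
    (hw : w =O[atTop] fun _ => (1 : ℝ)) :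
    (fun k => k * (A * k ^ 2 + B * k + C) / (m + k) ^ 2 + cert m k * w k) =O[atTop]
      fun k => k := by
  simpa only [mul_one] using
    (isBigO_mul_quadratic_div_sq m A B C).add (((isBigO_cert m).mul hw).congr_right mul_one)

end DixonTerm

section WeightedSums

variable {m C : ℝ} {X : ℕ → ℝ}

theorem abs_dixonTerm_mul_le {x : ℝ} {k : ℕ} (hm : 1 ≤ m)
    (hx : |x| ≤ C * ((k : ℝ) + 1) ^ (1 / 4 : ℝ)) :
    |dixonTerm m k * x| ≤ C * ((k : ℝ) + 1) ^ (-(5 / 4) : ℝ) := by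
  calc |dixonTerm m k * x| = dixonTerm m k * |x| := by
        rw [abs_mul, abs_of_nonneg (dixonTerm_nonneg hm k)]
    _ ≤ ((k : ℝ) + 1) ^ (-(3 / 2) : ℝ) * (C * ((k : ℝ) + 1) ^ (1 / 4 : ℝ)) :=
        mul_le_mul (dixonTerm_le hm k) hx (abs_nonneg x) (by positivity)
    _ = C * (((k : ℝ) + 1) ^ (-(3 / 2) : ℝ) * ((k : ℝ) + 1) ^ (1 / 4 : ℝ)) := by ring
    _ = C * ((k : ℝ) + 1) ^ (-(5 / 4) : ℝ) := by
        rw [← Real.rpow_add (by positivity)]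
        norm_num

theorem summable_succ_rpow (C : ℝ) : Summable fun k : ℕ => C * ((k : ℝ) + 1) ^ (-(5 / 4) : ℝ) := by
  have h : Summable fun k : ℕ => (k : ℝ) ^ (-(5 / 4) : ℝ) :=
    Real.summable_nat_rpow.2 (by norm_num)
  simpa using ((summable_nat_add_iff 1).2 h).mul_left C

theorem summable_dixonTerm_mul (hm : 1 ≤ m)
    (hX : ∀ k, |X k| ≤ C * ((k : ℝ) + 1) ^ (1 / 4 : ℝ)) :
    Summable fun k => dixonTerm m k * X k :=
  (summable_succ_rpow C).of_norm_bounded fun k => abs_dixonTerm_mul_le hm (hX k)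

theorem tendsto_mul_dixonTerm_mul {f : ℝ → ℝ} (hf : f =O[atTop] fun k => k) (hm : 1 ≤ m)
    (hX : ∀ k, |X k| ≤ C * ((k : ℝ) + 1) ^ (1 / 4 : ℝ)) :
    Tendsto (fun k : ℕ => f k * (dixonTerm m k * X k)) atTop (𝓝 0) := by
  have hdecay : (fun k => dixonTerm m k * X k) =O[atTop]
      fun k : ℕ => ((k : ℝ) + 1) ^ (-(5 / 4) : ℝ) :=
    .of_bound C <| .of_forall fun k => by
      rw [Real.norm_of_nonneg (by positivity : (0 : ℝ) ≤ ((k : ℝ) + 1) ^ (-(5 / 4) : ℝ))]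
      exact abs_dixonTerm_mul_le hm (hX k)
  have hlinear : (fun k : ℕ => f k) =O[atTop] fun k : ℕ => (k : ℝ) + 1 :=
    (hf.comp_tendsto tendsto_natCast_atTop_atTop).trans <| .of_bound 1 <| .of_forall fun k => by
      simp only [Function.comp, one_mul, Real.norm_eq_abs]
      exact abs_le_abs_of_nonneg k.cast_nonneg (by linarith)
  refine (hlinear.mul hdecay).trans_tendsto ?_
  refine ((tendsto_rpow_neg_atTop (by norm_num : (0 : ℝ) < 1 / 4)).comp
    (tendsto_atTop_add_const_right _ 1 tendsto_natCast_atTop_atTop)).congr fun k => ?_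
  rw [Function.comp, ← Real.rpow_one_add' (by positivity) (by norm_num)]
  norm_num

theorem tendsto_tsum_dixonTerm_mul {X : ℝ → ℕ → ℝ} {x : ℝ} (hX₀ : ∀ m, X m 0 = x)
    (hX : ∀ m, 1 ≤ m → ∀ k : ℕ, |X m k| ≤ C * ((k : ℝ) + 1) ^ (1 / 4 : ℝ)) :
    Tendsto (fun m => ∑' k, dixonTerm m k * X m k) atTop (𝓝 x) := by
  rw [← tsum_ite_eq (0 : ℕ) (fun _ => x)]
  refine tendsto_tsum_of_dominated_convergence (summable_succ_rpow C) (fun k => ?_) ?_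
  · split_ifs with hk
    · simp [hk, hX₀]
    · have hbound := (tendsto_dixonTerm hk).mul_const (C * ((k : ℝ) + 1) ^ (1 / 4 : ℝ))
      rw [zero_mul] at hbound
      refine squeeze_zero_norm' ?_ hbound
      filter_upwards [eventually_ge_atTop 1] with m hm
      rw [norm_mul, Real.norm_of_nonneg (dixonTerm_nonneg hm k)]
      exact mul_le_mul_of_nonneg_left (hX m hm k) (dixonTerm_nonneg hm k)
  · filter_upwards [eventually_ge_atTop 1] with m hm k using abs_dixonTerm_mul_le hm (hX m hm k)

end WeightedSums

section DixonSum

variable {m : ℝ}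

theorem abs_one_le_succ_rpow (k : ℕ) : |(1 : ℝ)| ≤ 1 * ((k : ℝ) + 1) ^ (1 / 4 : ℝ) := by
  rw [abs_one, one_mul]
  exact Real.one_le_rpow (le_add_of_nonneg_left k.cast_nonneg) (by norm_num)

theorem summable_dixonTerm (hm : 1 ≤ m) : Summable (dixonTerm m) := by
  simpa only [mul_one] using summable_dixonTerm_mul hm abs_one_le_succ_rpow

theorem tendsto_mul_dixonTerm {f : ℝ → ℝ} (hf : f =O[atTop] fun k => k) (hm : 1 ≤ m) :
    Tendsto (fun k : ℕ => f k * dixonTerm m k) atTop (𝓝 0) := by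
  simpa only [mul_one] using tendsto_mul_dixonTerm_mul hf hm abs_one_le_succ_rpow

theorem dixonSum_pos (hm : 1 ≤ m) : 0 < dixonSum m :=
  (summable_dixonTerm hm).tsum_pos (dixonTerm_nonneg hm) 0 (by simp)

theorem tendsto_dixonSum : Tendsto dixonSum atTop (𝓝 1) := by
  have h := tendsto_tsum_dixonTerm_mul (X := fun _ _ => 1) (fun _ => rfl)
    fun _ _ => abs_one_le_succ_rpow
  simp only [mul_one] at h
  exact h

theorem dixonSum_eq_shiftRatio_mul (hm : 1 ≤ m) :
    dixonSum m = shiftRatio m 0 * dixonSum (m + 2) := by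
  have hsum := summable_dixonTerm hm
  have hsum₂ := (summable_dixonTerm (by linarith : 1 ≤ m + 2)).mul_left (shiftRatio m 0)
  have htelescope (k : ℕ) : dixonTerm m k - shiftRatio m 0 * dixonTerm (m + 2) k =
      cert m (k + 1 : ℕ) * dixonTerm m (k + 1) - cert m k * dixonTerm m k := by
    rw [shiftRatio_mul_dixonTerm hm, dixonTerm_succ, Nat.cast_succ]
    linear_combination dixonTerm m k * one_sub_shiftRatio hm k.cast_nonneg
  have h := tsum_eq_of_telescope (hsum.sub hsum₂) htelescope
    (tendsto_mul_dixonTerm (isBigO_cert m) hm)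
  rw [hsum.tsum_sub hsum₂, tsum_mul_left, Nat.cast_zero, cert_zero, zero_mul, sub_zero] at h
  exact sub_eq_zero.1 h

theorem tendsto_add_two_mul_natCast (m : ℝ) : Tendsto (fun n : ℕ => m + 2 * n) atTop atTop :=
  tendsto_atTop_add_const_left _ m (tendsto_natCast_atTop_atTop.const_mul_atTop two_pos)

theorem dixonSum_eq_prod_mul (hm : 1 ≤ m) (n : ℕ) :
    dixonSum m = (∏ i ∈ range n, shiftRatio (m + 2 * i) 0) * dixonSum (m + 2 * n) := by
  induction n with
  | zero => simp
  | succ n ih =>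
    have hn : 1 ≤ m + 2 * n := by linarith [n.cast_nonneg (α := ℝ)]
    rw [ih, dixonSum_eq_shiftRatio_mul hn, prod_range_succ, mul_assoc, Nat.cast_succ, mul_add_one,
      ← add_assoc]

theorem shiftRatio_zero (hm : 1 ≤ m) :
    shiftRatio m 0 = ((m + 1 / 2) ^ 2 / (m * (m + 1))) ^ 2 := by
  have hm₀ : m * 2 - 1 ≠ 0 := by linarith
  simp only [shiftRatio, add_zero]
  field_simp

theorem tendsto_prod_range_shiftRatio (hm : 1 ≤ m) :
    Tendsto (fun n => ∏ i ∈ range n, shiftRatio (m + 2 * i) 0) atTop (𝓝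
      ((Real.Gamma (m / 2) * Real.Gamma ((m + 1) / 2) / Real.Gamma (m / 2 + 1 / 4) ^ 2) ^ 2)) := by
  have hfactor (i : ℕ) : shiftRatio (m + 2 * i) 0 =
      ((m / 2 + 1 / 4 + i) * (m / 2 + 1 / 4 + i) / ((m / 2 + i) * ((m + 1) / 2 + i))) ^ 2 := by
    have hi : 1 ≤ m + 2 * i := by linarith [i.cast_nonneg (α := ℝ)]
    rw [shiftRatio_zero hi]
    congr 1
    field_simp
    ring
  simp only [hfactor, prod_pow, sq (Real.Gamma (m / 2 + 1 / 4))]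
  exact (tendsto_prod_range_Gamma (by positivity) (by positivity) (by positivity) (by positivity)
    (by ring)).pow 2

theorem dixonSum_eq_Gamma (hm : 1 ≤ m) :
    dixonSum m =
      (Real.Gamma (m / 2) * Real.Gamma ((m + 1) / 2) / Real.Gamma (m / 2 + 1 / 4) ^ 2) ^ 2 := by
  have hlim := (tendsto_prod_range_shiftRatio hm).mul
    (tendsto_dixonSum.comp (tendsto_add_two_mul_natCast m))
  rw [mul_one] at hlim
  exact tendsto_nhds_unique tendsto_const_nhds <|
    hlim.congr fun n => (dixonSum_eq_prod_mul hm n).symm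

theorem dixonSum_one : dixonSum 1 = Real.pi / Real.Gamma (3 / 4) ^ 4 := by
  rw [dixonSum_eq_Gamma le_rfl, Real.Gamma_one_half_eq, add_self_div_two, Real.Gamma_one, mul_one,
    div_pow, Real.sq_sqrt Real.pi_nonneg, ← pow_mul]
  norm_num

end DixonSum

/-- First-order data of a deformation of the identity `one_sub_shiftRatio`: `δ` and `ρ` are the
logarithmic derivatives of `stepRatio` and `shiftRatio` along some direction in the space of
parameters of the hypergeometric family, and `g` is the derivative of `cert`. The field `telescope`
is the derivative of `one_sub_shiftRatio`, and `shift` that of the relation between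
`stepRatio (m + 2)` and `stepRatio m`. -/
structure DeformationCertificate (δ ρ g : ℝ → ℝ → ℝ) : Prop where
  exists_abs_le : ∃ C, ∀ m, 1 ≤ m → ∀ k, 0 ≤ k → |δ m k| ≤ C / (k + 1)
  shift : ∀ m k, ρ m (k + 1) - ρ m k = δ (m + 2) k - δ m k
  zero : ∀ m, g m 0 = 0
  isBigO : ∀ m, g m =O[atTop] fun k => k
  telescope : ∀ {m k}, 1 ≤ m → 0 ≤ k → -(shiftRatio m k * ρ m k) =
    cert m (k + 1) * stepRatio m k * δ m k + g m (k + 1) * stepRatio m k - g m k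

/-- The first-order variation of `dixonSum m` when `stepRatio m` has logarithmic derivative
`δ m`. -/
noncomputable def dixonSumVariation (δ : ℝ → ℝ → ℝ) (m : ℝ) : ℝ :=
  ∑' k, dixonTerm m k * ∑ j ∈ range k, δ m j

namespace DeformationCertificate

variable {δ ρ g : ℝ → ℝ → ℝ} {m : ℝ}

theorem exists_abs_sum_le (h : DeformationCertificate δ ρ g) :
    ∃ C, ∀ m, 1 ≤ m → ∀ k : ℕ, |∑ j ∈ range k, δ m j| ≤ C * ((k : ℝ) + 1) ^ (1 / 4 : ℝ) :=
  h.exists_abs_le.imp' ((1 + 1 / (1 / 4)) * ·) fun _ hC m hm =>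
    abs_sum_range_le (by norm_num) fun j => hC m hm j j.cast_nonneg

theorem summable (h : DeformationCertificate δ ρ g) (hm : 1 ≤ m) :
    Summable fun k => dixonTerm m k * ∑ j ∈ range k, δ m j := by
  obtain ⟨C, hC⟩ := h.exists_abs_sum_le
  exact summable_dixonTerm_mul hm (hC m hm)

theorem tendsto_dixonSumVariation (h : DeformationCertificate δ ρ g) :
    Tendsto (dixonSumVariation δ) atTop (𝓝 0) := by
  obtain ⟨C, hC⟩ := h.exists_abs_sum_le
  exact tendsto_tsum_dixonTerm_mul (fun m => sum_range_zero _) hC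

theorem sum_range_add_two (h : DeformationCertificate δ ρ g) (m : ℝ) (k : ℕ) :
    ∑ j ∈ range k, δ (m + 2) j = ∑ j ∈ range k, δ m j + (ρ m k - ρ m 0) := by
  induction k with
  | zero => simp
  | succ k ih =>
    rw [sum_range_succ, sum_range_succ, ih, Nat.cast_succ]
    linear_combination -h.shift m k

theorem dixonSumVariation_eq (h : DeformationCertificate δ ρ g) (hm : 1 ≤ m) :
    dixonSumVariation δ m =
      shiftRatio m 0 * (dixonSumVariation δ (m + 2) + ρ m 0 * dixonSum (m + 2)) := by
  obtain ⟨C, hC⟩ := h.exists_abs_sum_le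
  have hm₂ : 1 ≤ m + 2 := by linarith
  have hsum := h.summable hm
  have hsum₁ := h.summable hm₂
  have hsum₂ := (summable_dixonTerm hm₂).mul_left (ρ m 0)
  have hsum₃ := (hsum₁.add hsum₂).mul_left (shiftRatio m 0)
  have htelescope (k : ℕ) : dixonTerm m k * ∑ j ∈ range k, δ m j - shiftRatio m 0 *
      (dixonTerm (m + 2) k * ∑ j ∈ range k, δ (m + 2) j + ρ m 0 * dixonTerm (m + 2) k) =
      (cert m (k + 1 : ℕ) * (dixonTerm m (k + 1) * ∑ j ∈ range (k + 1), δ m j) +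
        g m (k + 1 : ℕ) * dixonTerm m (k + 1)) -
      (cert m k * (dixonTerm m k * ∑ j ∈ range k, δ m j) + g m k * dixonTerm m k) := by
    rw [h.sum_range_add_two, sum_range_succ, dixonTerm_succ, Nat.cast_succ]
    linear_combination
      -(∑ j ∈ range k, δ m j + ρ m k) * shiftRatio_mul_dixonTerm hm k +
      (dixonTerm m k * ∑ j ∈ range k, δ m j) * one_sub_shiftRatio hm k.cast_nonneg +
      dixonTerm m k * h.telescope hm k.cast_nonneg
  have hboundary := (tendsto_mul_dixonTerm_mul (isBigO_cert m) hm (hC m hm)).add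
    (tendsto_mul_dixonTerm (h.isBigO m) hm)
  have hzero := tsum_eq_of_telescope (hsum.sub hsum₃) htelescope hboundary
  rw [hsum.tsum_sub hsum₃, tsum_mul_left, hsum₁.tsum_add hsum₂, tsum_mul_left] at hzero
  rw [Nat.cast_zero, cert_zero, h.zero, zero_mul, zero_mul, add_zero, sub_zero] at hzero
  exact sub_eq_zero.1 hzero

theorem dixonSumVariation_div_dixonSum (h : DeformationCertificate δ ρ g) (hm : 1 ≤ m) :
    dixonSumVariation δ m / dixonSum m =
      ρ m 0 + dixonSumVariation δ (m + 2) / dixonSum (m + 2) := by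
  have hpos := dixonSum_pos hm
  rw [dixonSum_eq_shiftRatio_mul hm] at hpos
  have hratio := left_ne_zero_of_mul hpos.ne'
  have hsum := right_ne_zero_of_mul hpos.ne'
  rw [h.dixonSumVariation_eq hm, dixonSum_eq_shiftRatio_mul hm]
  field_simp
  ring

theorem dixonSumVariation_div_dixonSum_eq_sum (h : DeformationCertificate δ ρ g) (hm : 1 ≤ m)
    (n : ℕ) :
    dixonSumVariation δ m / dixonSum m = ∑ i ∈ range n, ρ (m + 2 * i) 0 +
      dixonSumVariation δ (m + 2 * n) / dixonSum (m + 2 * n) := by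
  induction n with
  | zero => simp
  | succ n ih =>
    have hn : 1 ≤ m + 2 * n := by linarith [n.cast_nonneg (α := ℝ)]
    rw [ih, h.dixonSumVariation_div_dixonSum hn, sum_range_succ, Nat.cast_succ, mul_add_one,
      add_assoc (∑ i ∈ range n, _), ← add_assoc m]

theorem hasSum (h : DeformationCertificate δ ρ g) (hm : 1 ≤ m) {s : ℝ}
    (hs : Tendsto (fun n => ∑ i ∈ range n, ρ (m + 2 * i) 0) atTop (𝓝 s)) :
    HasSum (fun k => dixonTerm m k * ∑ j ∈ range k, δ m j) (dixonSum m * s) := by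
  have hlim := hs.add ((h.tendsto_dixonSumVariation.div tendsto_dixonSum one_ne_zero).comp
    (tendsto_add_two_mul_natCast m))
  rw [zero_div, add_zero] at hlim
  have hquot : dixonSumVariation δ m / dixonSum m = s := tendsto_nhds_unique tendsto_const_nhds
    (hlim.congr fun n => (h.dixonSumVariation_div_dixonSum_eq_sum hm n).symm)
  rw [← hquot, mul_div_cancel₀ _ (dixonSum_pos hm).ne']
  exact (h.summable hm).hasSum

end DeformationCertificate

section Certificates

/-- The direction `₃F₂(m - 1/2, 1/2 + √ε, 1/2 - √ε; m, m; 1)`, summable by Whipple's theorem. -/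
theorem deformationCertificate_numerator :
    DeformationCertificate (fun _ k => -1 / (1 / 2 + k) ^ 2) (fun m _ => -2 / (m + 1 / 2) ^ 2)
      (fun m k => k * (m - 1 / 2 + k) / ((m - 1 / 2) * (m + 1 / 2) * (m + k) ^ 2)) where
  exists_abs_le := by
    refine ⟨4, fun m _ k hk => ?_⟩
    rw [neg_div, abs_neg, abs_of_nonneg (by positivity)]
    exact one_div_add_sq_le le_rfl hk
  shift _ _ := by rw [sub_self, sub_self]
  zero m := by simp
  isBigO m := by
    refine (isBigO_mul_quadratic_div_sq m 0 (1 / ((m - 1 / 2) * (m + 1 / 2)))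
      ((m - 1 / 2) / ((m - 1 / 2) * (m + 1 / 2)))).congr_left fun k => ?_
    generalize (m - 1 / 2) * (m + 1 / 2) = c
    rw [← div_div]
    ring
  telescope {m k} hm hk := by
    have hm₀ : m * 2 - 1 ≠ 0 := by linarith
    unfold shiftRatio cert stepRatio
    rw [← add_assoc m k 1]
    field_simp
    ring

/-- The direction `₃F₂(m - 1/2, 1/2, 1/2; m + √-ε, m - √-ε; 1)`, summable by Whipple's theorem. -/
theorem deformationCertificate_denominator :
    DeformationCertificate (fun m k => 1 / (m + k) ^ 2)
      (fun m k => -2 / (m + 1 / 2) ^ 2 + 1 / (m + k) ^ 2 + 1 / (m + k + 1) ^ 2)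
      (fun m k => cert m k / (m + k) ^ 2 -
        k * (k + 2 * m) / ((m - 1 / 2) * (m + 1 / 2) * (m + k) ^ 2)) where
  exists_abs_le := by
    refine ⟨4, fun m hm k hk => ?_⟩
    rw [abs_of_nonneg (by positivity)]
    exact one_div_add_sq_le (by linarith) hk
  shift _ _ := by ring
  zero m := by simp [cert]
  isBigO m := by
    have hw : (fun k : ℝ => 1 / (m + k) ^ 2) =O[atTop] fun _ => (1 : ℝ) := by
      simpa only [one_div_pow, one_pow] using (isBigO_one_div_add m).pow 2
    refine (isBigO_mul_quadratic_div_sq_add_cert_mul m 0 (-1 / ((m - 1 / 2) * (m + 1 / 2)))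
      (-(2 * m) / ((m - 1 / 2) * (m + 1 / 2))) hw).congr_left fun k => ?_
    generalize (m - 1 / 2) * (m + 1 / 2) = c
    rw [← div_div _ c]
    ring
  telescope {m k} hm hk := by
    have hm₀ : m * 2 - 1 ≠ 0 := by linarith
    unfold shiftRatio cert stepRatio
    rw [← add_assoc m k 1]
    field_simp
    ring

/-- The direction `₃F₂(m + ε - 1/2, 1/2, 1/2; m + ε, m + ε; 1)`. -/
theorem deformationCertificate_base :
    DeformationCertificate (fun m k => 1 / (m - 1 / 2 + k) - 2 / (m + k))
      (fun m k => 4 / (m + 1 / 2) - 1 / (m - 1 / 2) - 1 / (m + 1 / 2) +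
        (1 / (m - 1 / 2 + k) + 1 / (m + 1 / 2 + k)) - 2 * (1 / (m + k) + 1 / (m + k + 1)))
      (fun m k => -(k * (3 * k + 4 * m - 1)) / ((m - 1 / 2) * (m + k) ^ 2) -
        cert m k * (1 / (m - 1 / 2) + 2 / (m + k))) where
  exists_abs_le := by
    refine ⟨4, fun m hm k hk => ?_⟩
    have hbound : 0 ≤ 1 / (m - 1 / 2 + k) := one_div_nonneg.2 (by linarith)
    have h₁ := one_div_add_le (by linarith : 1 / 2 ≤ m - 1 / 2) hk
    have h₂ := one_div_add_le (by linarith : 1 / 2 ≤ m) hk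
    have h₃ : 0 ≤ 1 / (m + k) := by positivity
    rw [abs_le]
    have hpos : 0 ≤ 2 / (k + 1) := by positivity
    constructor
    · linear_combination hbound + 2 * h₂
    · linear_combination h₁ + 2 * h₃ + hpos
  shift _ _ := by ring
  zero m := by simp [cert]
  isBigO m := by
    have hw : (fun k : ℝ => -(1 / (m - 1 / 2)) - 2 * (1 / (m + k))) =O[atTop] fun _ => (1 : ℝ) :=
      (isBigO_const_one ℝ _ _).sub ((isBigO_one_div_add m).const_mul_left 2)
    refine (isBigO_mul_quadratic_div_sq_add_cert_mul m 0 (-3 / (m - 1 / 2))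
      (-(4 * m - 1) / (m - 1 / 2)) hw).congr_left fun k => ?_
    rw [← div_div _ (m - 1 / 2)]
    ring
  telescope {m k} hm hk := by
    have hm₀ : m * 2 - 1 ≠ 0 := by linarith
    have hk₀ : m * 2 - 1 + 2 * k ≠ 0 := by linarith
    unfold shiftRatio cert stepRatio
    rw [← add_assoc m k 1]
    field_simp
    ring

/-- The direction `₃F₂(m - 1/2, 1/2 + ε, 1/2; m - ε, m; 1)`, which remains well-poised. -/
theorem deformationCertificate_wellPoised :
    DeformationCertificate (fun m k => 1 / (1 / 2 + k) + 1 / (m + k))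
      (fun m k => 1 / (m - 1 / 2) - 3 / (m + 1 / 2) + 1 / (m + k) + 1 / (m + k + 1))
      (fun m k => cert m k / (m + k) -
        k * (1 / 2 + 2 * (m - 1 / 2 + k) * (m + 1 / 2 + k) / (m - 1 / 2)) /
          ((m - 1 / 2) * (m + k) ^ 2)) where
  exists_abs_le := by
    refine ⟨4, fun m hm k hk => ?_⟩
    rw [abs_of_nonneg (by positivity)]
    linear_combination one_div_add_le (le_refl (1 / 2)) hk +
      one_div_add_le (by linarith : 1 / 2 ≤ m) hk
  shift _ _ := by ring
  zero m := by simp [cert]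
  isBigO m := by
    refine (isBigO_mul_quadratic_div_sq_add_cert_mul m (-2 / (m - 1 / 2) / (m - 1 / 2))
      (-4 * m / (m - 1 / 2) / (m - 1 / 2))
      (-(1 / 2 + 2 * (m - 1 / 2) * (m + 1 / 2) / (m - 1 / 2)) / (m - 1 / 2))
      (isBigO_one_div_add m)).congr_left fun k => ?_
    rw [← div_div _ (m - 1 / 2)]
    ring
  telescope {m k} hm hk := by
    have hm₀ : m * 2 - 1 ≠ 0 := by linarith
    unfold shiftRatio cert stepRatio
    rw [← add_assoc m k 1]
    field_simp
    ring

end Certificates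

section HarmonicSums

theorem genHarmonic_eq_sum_range (r k : ℕ) :
    genHarmonic r k = ∑ j ∈ range k, 1 / (1 + (j : ℝ)) ^ r := by
  rw [genHarmonic, ← Finset.Ico_add_one_right_eq_Icc, sum_Ico_eq_sum_range]
  simp

theorem oddHarmonic_eq_sum_range (r k : ℕ) :
    oddHarmonic r k = (1 / 2) ^ r * ∑ j ∈ range k, 1 / (1 / 2 + (j : ℝ)) ^ r := by
  rw [oddHarmonic, ← Finset.Ico_add_one_right_eq_Icc, sum_Ico_eq_sum_range, mul_sum]
  refine sum_congr rfl fun j _ => ?_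
  rw [← one_div_pow, ← one_div_pow, ← mul_pow, one_div_mul_one_div]
  push_cast
  ring_nf

theorem cubeTerm_eq_dixonTerm_mul (X : ℕ → ℝ) (k : ℕ) : cubeTerm X k = dixonTerm 1 k * X k := by
  rw [cubeTerm, dixonTerm_one, div_pow, ← pow_mul, mul_comm k 3, pow_mul, Nat.centralBinom]
  norm_num
  ring

theorem hasSum_cubeTerm_succ {X : ℕ → ℝ} {s : ℝ} (hX : X 0 = 0)
    (h : HasSum (fun k => dixonTerm 1 k * X k) s) : HasSum (fun k => cubeTerm X (k + 1)) s := by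
  simpa [cubeTerm_eq_dixonTerm_mul, hX] using (hasSum_nat_add_iff' 1).2 h

theorem hasSum_dixonTerm_mul_oddHarmonic_two :
    HasSum (fun k => dixonTerm 1 k * oddHarmonic 2 k)
      (dixonSum 1 * (Real.pi ^ 2 / 8 - catalanConst)) := by
  have hlim : Tendsto (fun n => ∑ i ∈ range n, -2 / (1 + 2 * (i : ℝ) + 1 / 2) ^ 2) atTop
      (𝓝 (-8 * ((Real.pi ^ 2 / 8 - catalanConst) / 2))) := by
    refine (hasSum_one_div_three_mod_four_sq.mul_left (-8)).tendsto_sum_nat.congr fun n =>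
      sum_congr rfl fun i _ => ?_
    field_simp
    ring
  have h : HasSum (fun k => dixonTerm 1 k * oddHarmonic 2 k) _ :=
    ((deformationCertificate_numerator.hasSum le_rfl hlim).mul_left (-1 / 4)).congr_fun fun k => by
      simp only [oddHarmonic_eq_sum_range, neg_div, sum_neg_distrib]
      ring
  convert h using 1
  ring

theorem hasSum_dixonTerm_mul_genHarmonic_two :
    HasSum (fun k => dixonTerm 1 k * genHarmonic 2 k)
      (dixonSum 1 * (4 * catalanConst - Real.pi ^ 2 / 3)) := by
  have hlim : Tendsto (fun n => ∑ i ∈ range n, (-2 / (1 + 2 * (i : ℝ) + 1 / 2) ^ 2 +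
      1 / (1 + 2 * (i : ℝ) + 0) ^ 2 + 1 / (1 + 2 * (i : ℝ) + 0 + 1) ^ 2)) atTop
      (𝓝 (-8 * ((Real.pi ^ 2 / 8 - catalanConst) / 2) + Real.pi ^ 2 / 6)) := by
    refine ((hasSum_one_div_three_mod_four_sq.mul_left (-8)).tendsto_sum_nat.add
      tendsto_sum_range_zeta_two_pairs).congr fun n => ?_
    rw [← sum_add_distrib]
    refine sum_congr rfl fun i _ => ?_
    field_simp
    ring
  convert deformationCertificate_denominator.hasSum le_rfl hlim using 2
  · rw [genHarmonic_eq_sum_range]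
  · ring

theorem hasSum_dixonTerm_mul_two_oddHarmonic_sub_two_genHarmonic :
    HasSum (fun k => dixonTerm 1 k * (2 * oddHarmonic 1 k - 2 * genHarmonic 1 k))
      (dixonSum 1 * (4 * Real.log 2 - Real.pi)) := by
  have hlim : Tendsto (fun n => ∑ i ∈ range n, (4 / (1 + 2 * (i : ℝ) + 1 / 2) -
      1 / (1 + 2 * (i : ℝ) - 1 / 2) - 1 / (1 + 2 * (i : ℝ) + 1 / 2) +
      (1 / (1 + 2 * (i : ℝ) - 1 / 2 + 0) + 1 / (1 + 2 * (i : ℝ) + 1 / 2 + 0)) -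
      2 * (1 / (1 + 2 * (i : ℝ) + 0) + 1 / (1 + 2 * (i : ℝ) + 0 + 1)))) atTop
      (𝓝 (4 * Real.log 2 - 4 * (Real.pi / 4))) := by
    refine ((tendsto_sum_range_log_two_four_terms.const_mul 4).sub
      (tendsto_sum_range_leibniz_pairs.const_mul 4)).congr fun n => ?_
    rw [mul_sum, mul_sum, ← sum_sub_distrib]
    refine sum_congr rfl fun i _ => ?_
    have hsub : 1 + 2 * (i : ℝ) - 1 / 2 = (4 * i + 1) / 2 := by ring
    have hadd : 1 + 2 * (i : ℝ) + 1 / 2 = (4 * i + 3) / 2 := by ring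
    rw [hsub, hadd]
    field_simp
    ring
  convert deformationCertificate_base.hasSum le_rfl hlim using 1
  · ext k
    rw [oddHarmonic_eq_sum_range, genHarmonic_eq_sum_range, ← mul_assoc, mul_sum, mul_sum,
      ← sum_sub_distrib]
    congr! 2
    ring_nf
  · ring

theorem hasSum_dixonTerm_mul_two_oddHarmonic_add_genHarmonic :
    HasSum (fun k => dixonTerm 1 k * (2 * oddHarmonic 1 k + genHarmonic 1 k))
      (dixonSum 1 * (Real.pi - 2 * Real.log 2)) := by
  have hlim : Tendsto (fun n => ∑ i ∈ range n, (1 / (1 + 2 * (i : ℝ) - 1 / 2) -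
      3 / (1 + 2 * (i : ℝ) + 1 / 2) + 1 / (1 + 2 * (i : ℝ) + 0) +
      1 / (1 + 2 * (i : ℝ) + 0 + 1))) atTop (𝓝 (4 * (Real.pi / 4) - 2 * Real.log 2)) := by
    refine ((tendsto_sum_range_leibniz_pairs.const_mul 4).sub
      (tendsto_sum_range_log_two_four_terms.const_mul 2)).congr fun n => ?_
    rw [mul_sum, mul_sum, ← sum_sub_distrib]
    refine sum_congr rfl fun i _ => ?_
    have hsub : 1 + 2 * (i : ℝ) - 1 / 2 = (4 * i + 1) / 2 := by ring
    have hadd : 1 + 2 * (i : ℝ) + 1 / 2 = (4 * i + 3) / 2 := by ring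
    rw [hsub, hadd]
    field_simp
    ring
  convert deformationCertificate_wellPoised.hasSum le_rfl hlim using 1
  · ext k
    rw [oddHarmonic_eq_sum_range, genHarmonic_eq_sum_range, ← mul_assoc, mul_sum,
      ← sum_add_distrib]
    congr! 2
    ring_nf
  · ring

theorem hasSum_dixonTerm_mul_genHarmonic_one :
    HasSum (fun k => dixonTerm 1 k * genHarmonic 1 k)
      (dixonSum 1 * (2 * (Real.pi - 3 * Real.log 2) / 3)) := by
  have h : HasSum (fun k => dixonTerm 1 k * genHarmonic 1 k) _ :=
    ((hasSum_dixonTerm_mul_two_oddHarmonic_add_genHarmonic.sub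
      hasSum_dixonTerm_mul_two_oddHarmonic_sub_two_genHarmonic).div_const 3).congr_fun
        fun k => by ring
  convert h using 1
  ring

theorem hasSum_dixonTerm_mul_oddHarmonic_one :
    HasSum (fun k => dixonTerm 1 k * oddHarmonic 1 k) (dixonSum 1 * (Real.pi / 6)) := by
  have h : HasSum (fun k => dixonTerm 1 k * oddHarmonic 1 k) _ :=
    (((hasSum_dixonTerm_mul_two_oddHarmonic_add_genHarmonic.mul_left 2).add
      hasSum_dixonTerm_mul_two_oddHarmonic_sub_two_genHarmonic).div_const 6).congr_fun
        fun k => by ring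
  convert h using 1
  ring

end HarmonicSums

theorem mainTheorem1 :
    HasSum (fun k : ℕ => cubeTerm (genHarmonic 1) (k + 1))
      (2 * Real.pi * (Real.pi - 3 * Real.log 2) / (3 * Real.Gamma (3 / 4) ^ 4)) ∧
    HasSum (fun k : ℕ => cubeTerm (oddHarmonic 1) (k + 1))
      (Real.pi ^ 2 / (6 * Real.Gamma (3 / 4) ^ 4)) ∧
    HasSum (fun k : ℕ => cubeTerm (genHarmonic 2) (k + 1))
      (Real.pi * (12 * catalanConst - Real.pi ^ 2) / (3 * Real.Gamma (3 / 4) ^ 4)) ∧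
    HasSum (fun k : ℕ => cubeTerm (oddHarmonic 2) (k + 1))
      (Real.pi * (Real.pi ^ 2 - 8 * catalanConst) / (8 * Real.Gamma (3 / 4) ^ 4)) := by
  have hgen (r : ℕ) : genHarmonic r 0 = 0 := by simp [genHarmonic]
  have hodd (r : ℕ) : oddHarmonic r 0 = 0 := by simp [oddHarmonic]
  refine ⟨?_, ?_, ?_, ?_⟩
  · convert hasSum_cubeTerm_succ (hgen 1) hasSum_dixonTerm_mul_genHarmonic_one using 1
    rw [dixonSum_one]
    ring
  · convert hasSum_cubeTerm_succ (hodd 1) hasSum_dixonTerm_mul_oddHarmonic_one using 1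
    rw [dixonSum_one]
    ring
  · convert hasSum_cubeTerm_succ (hgen 2) hasSum_dixonTerm_mul_genHarmonic_two using 1
    rw [dixonSum_one]
    ring
  · convert hasSum_cubeTerm_succ (hodd 2) hasSum_dixonTerm_mul_oddHarmonic_two using 1
    rw [dixonSum_one]
    ring
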